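/- Let $\alpha\in(0,\tfrac1{11})$ be fixed and let $k=k(n)\ge 0$ be integers with $k=O(n^\alpha)$ as $n\to\infty$. For each $n\ge 1$ let $T_1,\ldots,T_k$ be chosen independently and uniformly at random from the set of spanning trees of the complete graph $K_n$ on $n$ labelled vertices, and let $M_n:=k(n-1)-|\bigcup_i T_i|$, where $|\cdot|$ denotes the number of edges. Let $\mathrm{Po}(\lambda)$ be the Poisson distribution with parameter $\lambda$ (the point mass at $0$ if $\lambda=0$). Then the total variation distance $\sup_{A\subseteq\mathbb Z}|\mathbb P[M_n\in A]-\mathbb P[\mathrm{Po}(k(k-1))\in A]|$ between $M_n$ and $\mathrm{Po}(k(k-1))$ tends to $0$ as $n\to\infty$. More specifically, \[ \sum_{a=0}^{\infty}\bigl|\mathbb P[M_n=a]-\mathbb P[\mathrm{Po}(k(k-1))=a]\bigr|=O\!\left(\frac{n^{11\alpha}}{n}\right)=o(1), \] and the total variation distance is likewise $O(n^{11\alpha}/n)$. -/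

import Mathlib

open Filter Topology Asymptotics MeasureTheory ProbabilityTheory

/-- The set `τ(G)` of spanning trees of a graph `G`. -/
def spanningTrees {V : Type*} (G : SimpleGraph V) : Set (SimpleGraph V) :=
  {T | T ≤ G ∧ T.IsTree}

/-- For graphs `T₁, …, T_k` on `n` vertices, the integer `k(n-1) - |⋃ᵢ Tᵢ|`, where `|·|` counts
edges. All operations are in `ℤ`, so nothing is truncated. -/
noncomputable def unionDeficit {n k : ℕ} (T : Fin k → SimpleGraph (Fin n)) : ℤ :=
  (k : ℤ) * ((n : ℤ) - 1) - ((⋃ i, (T i).edgeSet).ncard : ℤ)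

/-- Total variation distance `sup_A |μ(A) - ν(A)|` over the measurable sets `A`. It is meant for
probability measures, for which the supremum is over a nonempty set bounded by `1`. -/
noncomputable def tvDist {X : Type*} [MeasurableSpace X] (μ ν : Measure X) : ℝ :=
  ⨆ A : {A : Set X // MeasurableSet A}, |μ.real A.1 - ν.real A.1|

/-- The rate `k(k-1)` (for `k = 0` it is `0`, as it should be). -/
def poissonRate (k : ℕ) : NNReal := ((k * (k - 1) : ℕ) : NNReal)

/-- The Poisson distribution with parameter `r`, as a distribution on `ℤ`. -/
noncomputable def poissonInt (r : NNReal) : Measure ℤ :=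
  (poissonMeasure r).map (fun a : ℕ => (a : ℤ))

/-- The `a`-th term `|P[M = a] - P[Po(r) = a]|` of the sum of the differences of the point
probabilities of `M` and of the Poisson distribution with parameter `r`. -/
noncomputable def massGap {Ω : Type*} [MeasurableSpace Ω] (P : Measure Ω) (M : Ω → ℤ)
    (r : NNReal) (a : ℕ) : ℝ :=
  |P.real {ω | M ω = (a : ℤ)} - (poissonMeasure r).real {a}|

namespace SimpleGraph
variable {V : Type*} {T : SimpleGraph V} {u v w x : V}

/-- In a tree, `w` is the neighbour of `v` in the direction of `u`: it is joined to `u` without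
the edge `vw`. -/
def NextToward (T : SimpleGraph V) (v w u : V) : Prop :=
  T.Adj v w ∧ (T.deleteEdges {s(v, w)}).Reachable w u

/-- Replace the edge `vw` by the edge `vu`. -/
def reroute (T : SimpleGraph V) (v w u : V) : SimpleGraph V :=
  T.deleteEdges {s(v, w)} ⊔ edge v u

lemma IsTree.not_reachable_deleteEdges (hT : T.IsTree) (h : T.Adj v w) :
    ¬ (T.deleteEdges {s(v, w)}).Reachable v w :=
  isBridge_iff.1 (isAcyclic_iff_forall_adj_isBridge.1 hT.isAcyclic h)

lemma IsTree.reachable_deleteEdges_or (hT : T.IsTree) (v w x : V) :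
    (T.deleteEdges {s(v, w)}).Reachable x v ∨ (T.deleteEdges {s(v, w)}).Reachable x w := by
  obtain ⟨p⟩ := hT.connected x v
  suffices H : ∀ {x y : V}, T.Walk x y → y = v →
      (T.deleteEdges {s(v, w)}).Reachable x v ∨ (T.deleteEdges {s(v, w)}).Reachable x w from
    H p rfl
  intro x y p
  induction p with
  | nil => rintro rfl; exact Or.inl (Reachable.refl _)
  | @cons a b c h p ih =>
    intro hc
    by_cases he : s(a, b) = s(v, w)
    · rcases Sym2.eq_iff.1 he with ⟨rfl, rfl⟩ | ⟨rfl, rfl⟩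
      · exact Or.inl (Reachable.refl _)
      · exact Or.inr (Reachable.refl _)
    · have hab : (T.deleteEdges {s(v, w)}).Adj a b := by
        simp only [deleteEdges_adj, Set.mem_singleton_iff]; exact ⟨h, he⟩
      exact (ih hc).imp hab.reachable.trans hab.reachable.trans

lemma NextToward.not_reachable (hT : T.IsTree) (h : T.NextToward v w u) :
    ¬ (T.deleteEdges {s(v, w)}).Reachable v u :=
  fun h' => hT.not_reachable_deleteEdges h.1 (h'.trans h.2.symm)

lemma NextToward.isTree_reroute (hT : T.IsTree) (h : T.NextToward v w u) :
    (T.reroute v w u).IsTree := by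
  have hn := h.not_reachable hT
  have hvu : v ≠ u := fun e => hn (e ▸ Reachable.refl _)
  have hle : T.deleteEdges {s(v, w)} ≤ T.reroute v w u := le_sup_left
  have hadj : (T.reroute v w u).Adj v u := by
    simp [reroute, edge_adj, hvu]
  have := hT.connected.nonempty
  refine ⟨⟨fun x y => ?_⟩, ?_⟩
  · have key : ∀ x, (T.reroute v w u).Reachable x v := by
      intro x
      rcases hT.reachable_deleteEdges_or v w x with hx | hx
      · exact hx.mono hle
      · exact ((hx.trans h.2).mono hle).trans hadj.symm.reachable
    exact (key x).trans (key y).symm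
  · exact (hT.isAcyclic.anti (deleteEdges_le _)).sup_edge_of_not_reachable hn

lemma NextToward.deleteEdges_reroute (hT : T.IsTree) (h : T.NextToward v w u) :
    (T.reroute v w u).deleteEdges {s(v, u)} = T.deleteEdges {s(v, w)} := by
  have hn := h.not_reachable hT
  have hna : ¬ (T.deleteEdges {s(v, w)}).Adj v u := fun h' => hn h'.reachable
  ext a b
  rw [deleteEdges_adj, reroute, sup_adj, edge_adj, Set.mem_singleton_iff]
  constructor
  · rintro ⟨h1 | h1, h2⟩
    · exact h1
    · exact absurd (Sym2.eq_iff.2 h1.1) h2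
  · intro h1
    refine ⟨Or.inl h1, fun h2 => hna ?_⟩
    rw [← mem_edgeSet, ← h2]; exact h1

lemma NextToward.reroute_swap (hT : T.IsTree) (h : T.NextToward v w u) :
    (T.reroute v w u).NextToward v u w := by
  have hn := h.not_reachable hT
  have hvu : v ≠ u := fun e => hn (e ▸ Reachable.refl _)
  refine ⟨by simp [reroute, edge_adj, hvu], ?_⟩
  rw [h.deleteEdges_reroute hT]
  exact h.2.symm

lemma NextToward.reroute_reroute (hT : T.IsTree) (h : T.NextToward v w u) :
    (T.reroute v w u).reroute v u w = T := by
  rw [reroute, h.deleteEdges_reroute hT]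
  ext a b
  rw [sup_adj, edge_adj, deleteEdges_adj, Set.mem_singleton_iff]
  have := h.1
  have hne := h.1.ne
  constructor
  · rintro (h1 | ⟨⟨rfl, rfl⟩ | ⟨rfl, rfl⟩, -⟩)
    · exact h1.1
    · exact this
    · exact this.symm
  · intro h1
    by_cases he : s(a, b) = s(v, w)
    · exact Or.inr ⟨Sym2.eq_iff.1 he, h1.ne⟩
    · exact Or.inl ⟨h1, he⟩

lemma IsTree.existsUnique_nextToward (hT : T.IsTree) (hvu : v ≠ u) :
    ∃! w, T.NextToward v w u := by
  classical
  obtain ⟨p, hp, hpu⟩ := hT.existsUnique_path v u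
  cases p with
  | nil => exact absurd rfl hvu
  | @cons _ w _ h q =>
    rw [Walk.cons_isPath_iff] at hp
    refine ⟨w, ⟨h, ?_⟩, fun w' hw' => ?_⟩
    · refine ⟨q.toDeleteEdges _ fun e he => ?_⟩
      rintro rfl
      exact hp.2 (q.fst_mem_support_of_mem_edges he)
    · obtain ⟨q', hq'⟩ := hw'.2.exists_isPath
      have hv : v ∉ q'.support := fun hv =>
        hT.not_reachable_deleteEdges hw'.1 (q'.takeUntil v hv).reachable.symm
      have hle := deleteEdges_le (G := T) {s(v, w')}
      have := hpu (.cons hw'.1 (q'.mapLe hle)) (by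
        simp only
        rw [Walk.cons_isPath_iff]
        exact ⟨(Walk.isPath_mapLe hle).2 hq', by simpa using hv⟩)
      simp only [Walk.cons.injEq] at this
      exact this.1

lemma NextToward.adj_of_reroute_adj {y : V} (h : (T.reroute v w u).Adj x y)
    (hne : s(x, y) ≠ s(v, u)) : T.Adj x y := by
  rw [reroute, sup_adj, edge_adj] at h
  rcases h with h | h
  · exact deleteEdges_le _ h
  · exact absurd (Sym2.eq_iff.2 h.1) hne

section Finite
variable [Fintype V]

/-- The number of common edges of two graphs. -/
noncomputable def overlap (T G : SimpleGraph V) : ℕ := (T ⊓ G).edgeSet.ncard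

open Classical in
lemma overlap_deleteEdges (G : SimpleGraph V) (h : T.Adj v w) :
    T.overlap G = (T.deleteEdges {s(v, w)}).overlap G + if G.Adj v w then 1 else 0 := by
  have e : (T.deleteEdges {s(v, w)} ⊓ G).edgeSet = (T ⊓ G).edgeSet \ {s(v, w)} := by
    ext x
    induction x with | h a b => simp; tauto
  rw [overlap, overlap, e]
  split_ifs with hG
  · rw [Set.ncard_sdiff_singleton_add_one]
    simp [h, hG]
  · rw [Set.sdiff_singleton_eq_self, add_zero]
    simp [hG]

open Classical in
lemma NextToward.overlap_reroute (G : SimpleGraph V) (hT : T.IsTree) (h : T.NextToward v w u) :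
    (T.reroute v w u).overlap G + (if G.Adj v w then 1 else 0) =
      T.overlap G + if G.Adj v u then 1 else 0 := by
  rw [overlap_deleteEdges G h.1, overlap_deleteEdges G (h.reroute_swap hT).1,
    h.deleteEdges_reroute hT]
  ring

open Classical in
lemma two_mul_overlap (T G : SimpleGraph V) :
    2 * T.overlap G = ∑ v, ∑ u, if T.Adj v u ∧ G.Adj v u then 1 else 0 := by
  have h : T.overlap G = (T ⊓ G).edgeFinset.card := by
    rw [overlap, Set.ncard_eq_toFinset_card']
    congr!
  trans ∑ v, (T ⊓ G).degree v
  · rw [h]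
    convert! (sum_degrees_eq_twice_card_edges (T ⊓ G)).symm
  refine Finset.sum_congr rfl fun v _ => ?_
  rw [← card_neighborFinset_eq_degree, Finset.sum_boole, neighborFinset_eq_filter]
  simp

/-- Labelled trees on the vertex set `V`. -/
abbrev LabelledTree (V : Type*) := {T : SimpleGraph V // T.IsTree}

noncomputable instance : Fintype (LabelledTree V) := Fintype.ofFinite _

instance [Nonempty V] : Nonempty (LabelledTree V) :=
  let ⟨T, _, hT⟩ := (connected_top (V := V)).exists_isTree_le
  ⟨⟨T, hT⟩⟩

open Classical in
lemma sum_nextToward_reroute (v u : V) (f : SimpleGraph V → V → ℝ) :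
    ∑ T : LabelledTree V, ∑ w, (if T.1.NextToward v w u then f (T.1.reroute v w u) w else 0) =
      ∑ T : LabelledTree V, ∑ w, if T.1.NextToward v u w then f T.1 w else 0 := by
  simp_rw [← Fintype.sum_prod_type', ← Finset.sum_filter]
  refine Finset.sum_bij'
    (fun x hx => (⟨x.1.1.reroute v x.2 u,
      ((Finset.mem_filter.1 hx).2 : x.1.1.NextToward v x.2 u).isTree_reroute x.1.2⟩, x.2))
    (fun x hx => (⟨x.1.1.reroute v u x.2,
      ((Finset.mem_filter.1 hx).2 : x.1.1.NextToward v u x.2).isTree_reroute x.1.2⟩, x.2))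
    ?_ ?_ ?_ ?_ ?_
  · intro x hx
    have h : x.1.1.NextToward v x.2 u := (Finset.mem_filter.1 hx).2
    exact Finset.mem_filter.2 ⟨Finset.mem_univ _, h.reroute_swap x.1.2⟩
  · intro x hx
    have h : x.1.1.NextToward v u x.2 := (Finset.mem_filter.1 hx).2
    exact Finset.mem_filter.2 ⟨Finset.mem_univ _, h.reroute_swap x.1.2⟩
  · intro x hx
    have h : x.1.1.NextToward v x.2 u := (Finset.mem_filter.1 hx).2
    ext1
    · exact Subtype.ext (h.reroute_reroute x.1.2)
    · rfl
  · intro x hx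
    have h : x.1.1.NextToward v u x.2 := (Finset.mem_filter.1 hx).2
    ext1
    · exact Subtype.ext (h.reroute_reroute x.1.2)
    · rfl
  · intro x hx
    rfl

open Classical in
lemma IsTree.sum_nextToward (hT : T.IsTree) (hvu : v ≠ u) (c : ℝ) :
    ∑ w, (if T.NextToward v w u then c else 0) = c := by
  obtain ⟨w, hw, hu⟩ := hT.existsUnique_nextToward hvu
  rw [Finset.sum_eq_single w (fun b _ hb => if_neg fun h => hb (hu b h)) (by simp), if_pos hw]

open Classical in
lemma IsTree.sum_nextToward_add (hT : T.IsTree) (v u : V) (c : ℝ) :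
    ∑ w, (if T.NextToward v u w then c else 0) + ∑ w, (if T.NextToward u v w then c else 0) =
      if T.Adj v u then Fintype.card V * c else 0 := by
  rw [← Finset.sum_add_distrib]
  split_ifs with h
  · rw [← nsmul_eq_mul, ← Finset.card_univ, ← Finset.sum_const]
    refine Finset.sum_congr rfl fun w _ => ?_
    simp only [NextToward, h, h.symm, true_and, Sym2.eq_swap (a := u) (b := v)]
    have h1 := hT.not_reachable_deleteEdges h
    have h2 := hT.reachable_deleteEdges_or v u w
    by_cases hv : (T.deleteEdges {s(v, u)}).Reachable v w
    · have : ¬ (T.deleteEdges {s(v, u)}).Reachable u w := fun h' => h1 (hv.trans h'.symm)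
      simp [hv, this]
    · have : (T.deleteEdges {s(v, u)}).Reachable u w :=
        (h2.resolve_left fun h' => hv h'.symm).symm
      simp [hv, this]
  · refine Finset.sum_eq_zero fun w _ => ?_
    have h' : ¬ T.Adj u v := fun h' => h h'.symm
    simp [NextToward, h, h']

open Classical in
/-- Rerouting a uniform tree, in one of the two directions chosen at random, produces
a uniform tree among those that contain a given edge. -/
lemma card_mul_sum_adj (v u : V) (F : SimpleGraph V → ℝ) :
    Fintype.card V * ∑ T : LabelledTree V, (if T.1.Adj v u then F T.1 else 0) =
      ∑ T : LabelledTree V, ∑ w, (if T.1.NextToward v w u then F (T.1.reroute v w u) else 0) +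
      ∑ T : LabelledTree V, ∑ w, (if T.1.NextToward u w v then F (T.1.reroute u w v) else 0) := by
  rw [sum_nextToward_reroute v u fun T _ => F T, sum_nextToward_reroute u v fun T _ => F T,
    ← Finset.sum_add_distrib, Finset.mul_sum]
  refine Finset.sum_congr rfl fun T _ => ?_
  rw [T.2.sum_nextToward_add v u, mul_ite, mul_zero]

open Classical in
lemma card_mul_card_adj (hvu : v ≠ u) :
    Fintype.card V * ∑ T : LabelledTree V, (if T.1.Adj v u then (1 : ℝ) else 0) =
      2 * Fintype.card (LabelledTree V) := by
  rw [card_mul_sum_adj v u fun _ => 1]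
  simp_rw [fun T : LabelledTree V => T.2.sum_nextToward hvu 1,
    fun T : LabelledTree V => T.2.sum_nextToward hvu.symm 1]
  simp; ring

open Classical in
lemma degree_eq_sum_ite (G : SimpleGraph V) (v : V) :
    (G.degree v : ℝ) = ∑ u, if G.Adj v u then 1 else 0 := by
  rw [← card_neighborFinset_eq_degree, Finset.sum_boole, neighborFinset_eq_filter]

open Classical in
lemma card_adj_le (v u : V) :
    ∑ T : LabelledTree V, (if T.1.Adj v u then (1 : ℝ) else 0) ≤
      2 * Fintype.card (LabelledTree V) / Fintype.card V := by
  rcases eq_or_ne v u with rfl | h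
  · simp only [SimpleGraph.irrefl, if_false, Finset.sum_const_zero]
    positivity
  · have : Nonempty V := ⟨v⟩
    rw [← card_mul_card_adj h, mul_div_cancel_left₀]
    positivity

open Classical in
lemma card_adj_adj_le (h : w ≠ u) (v : V) :
    ∑ T : LabelledTree V, (if T.1.Adj v w then if T.1.Adj v u then (1 : ℝ) else 0 else 0) ≤
      4 * Fintype.card (LabelledTree V) / (Fintype.card V : ℝ) ^ 2 := by
  rcases eq_or_ne v w with rfl | hvw
  · simp only [SimpleGraph.irrefl, if_false, Finset.sum_const_zero]
    positivity
  have : Nonempty V := ⟨v⟩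
  have hn : (0 : ℝ) < Fintype.card V := by positivity
  have hs : s(v, u) ≠ s(v, w) := fun e => h (Sym2.congr_right.1 e).symm
  have key := card_mul_sum_adj v w fun T => if T.Adj v u then (1 : ℝ) else 0
  have le1 : ∑ T : LabelledTree V, ∑ x, (if T.1.NextToward v x w then
      (if (T.1.reroute v x w).Adj v u then (1 : ℝ) else 0) else 0) ≤
      2 * Fintype.card (LabelledTree V) / Fintype.card V := by
    refine le_trans (Finset.sum_le_sum fun T _ => ?_) (card_adj_le v u)
    rw [← T.2.sum_nextToward hvw (if T.1.Adj v u then (1 : ℝ) else 0)]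
    refine Finset.sum_le_sum fun x _ => ?_
    have := NextToward.adj_of_reroute_adj (T := T.1) (v := v) (w := x) (u := w) (x := v) (y := u)
    split_ifs <;> simp_all
  have le2 : ∑ T : LabelledTree V, ∑ x, (if T.1.NextToward w x v then
      (if (T.1.reroute w x v).Adj v u then (1 : ℝ) else 0) else 0) ≤
      2 * Fintype.card (LabelledTree V) / Fintype.card V := by
    refine le_trans (Finset.sum_le_sum fun T _ => ?_) (card_adj_le v u)
    rw [← T.2.sum_nextToward hvw.symm (if T.1.Adj v u then (1 : ℝ) else 0)]
    refine Finset.sum_le_sum fun x _ => ?_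
    have := NextToward.adj_of_reroute_adj (T := T.1) (v := w) (w := x) (u := v) (x := v) (y := u)
    rw [Sym2.eq_swap (a := w)] at this
    split_ifs <;> simp_all
  have h2 : 4 * Fintype.card (LabelledTree V) / (Fintype.card V : ℝ) ^ 2 =
      (2 * Fintype.card (LabelledTree V) / Fintype.card V +
        2 * Fintype.card (LabelledTree V) / Fintype.card V) / (Fintype.card V : ℝ) := by
    field_simp
    norm_num
  rw [h2, le_div_iff₀' hn, key]
  exact add_le_add le1 le2

open Classical in
lemma sum_degree_sq_le (v : V) :
    ∑ T : LabelledTree V, (T.1.degree v : ℝ) ^ 2 ≤ 6 * Fintype.card (LabelledTree V) := by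
  have : Nonempty V := ⟨v⟩
  have hn : (0 : ℝ) < Fintype.card V := by positivity
  set N : ℝ := ((Fintype.card (LabelledTree V) : ℕ) : ℝ)
  set n : ℝ := ((Fintype.card V : ℕ) : ℝ)
  have e : ∀ T : LabelledTree V, (T.1.degree v : ℝ) ^ 2 =
      ∑ w, ∑ u, if T.1.Adj v w then if T.1.Adj v u then (1 : ℝ) else 0 else 0 := by
    intro T
    rw [degree_eq_sum_ite, sq, Finset.sum_mul_sum]
    simp_rw [ite_mul, one_mul, zero_mul]
  simp_rw [e]
  rw [Finset.sum_comm]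
  have hN : 0 ≤ N := by positivity
  calc _ ≤ ∑ w : V, ∑ u : V, ((if u = w then 2 * N / n else 0) + 4 * N / n ^ 2) := by
        refine Finset.sum_le_sum fun w _ => ?_
        rw [Finset.sum_comm]
        refine Finset.sum_le_sum fun u _ => ?_
        split_ifs with huw
        · subst huw
          refine le_trans (le_trans (Finset.sum_le_sum fun T _ => ?_) (card_adj_le v u))
            (le_add_of_nonneg_right (by positivity))
          split_ifs <;> simp
        · rw [zero_add]
          exact card_adj_adj_le (Ne.symm huw) v
    _ = 6 * N := by
        simp only [Finset.sum_add_distrib, Finset.sum_ite_eq', Finset.mem_univ, if_true,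
          Finset.sum_const, Finset.card_univ, nsmul_eq_mul]
        change n * (2 * N / n) + n * (n * (4 * N / n ^ 2)) = _
        field_simp
        ring

open Classical in
lemma abs_sum_reroute_sub_le (G : SimpleGraph V) {v u : V} (h : G.Adj v u) {g : ℕ → ℝ} {B : ℝ}
    (hg : ∀ a, |g a| ≤ B) :
    |∑ T : LabelledTree V, ∑ w, (if T.1.NextToward v w u then
        g ((T.1.reroute v w u).overlap G) else 0) -
      ∑ T : LabelledTree V, g (T.1.overlap G + 1)| ≤
      2 * B * (G.degree v * (2 * Fintype.card (LabelledTree V) / Fintype.card V)) := by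
  have hB : 0 ≤ B := (abs_nonneg _).trans (hg 0)
  have e : ∀ T : LabelledTree V, g (T.1.overlap G + 1) =
      ∑ w, if T.1.NextToward v w u then g (T.1.overlap G + 1) else 0 :=
    fun T => (T.2.sum_nextToward h.ne _).symm
  rw [Finset.sum_congr rfl fun T _ => e T]
  simp_rw [← Finset.sum_sub_distrib]
  calc _ ≤ ∑ T : LabelledTree V, ∑ w, (if G.Adj v w then
        2 * B * if T.1.Adj v w then 1 else 0 else 0) := by
        refine (Finset.abs_sum_le_sum_abs _ _).trans (Finset.sum_le_sum fun T _ =>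
          (Finset.abs_sum_le_sum_abs _ _).trans (Finset.sum_le_sum fun w _ => ?_))
        by_cases hw : T.1.NextToward v w u
        · have h1 := hw.overlap_reroute G T.2
          rw [if_pos h] at h1
          rw [if_pos hw, if_pos hw, if_pos hw.1]
          by_cases hG : G.Adj v w
          · rw [if_pos hG, mul_one, two_mul]
            exact (abs_sub _ _).trans (add_le_add (hg _) (hg _))
          · rw [if_neg hG, add_zero] at h1
            rw [if_neg hG, h1, sub_self, abs_zero]
        · rw [if_neg hw, if_neg hw, sub_self, abs_zero]
          split_ifs <;> positivity
    _ = ∑ w, if G.Adj v w then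
        2 * B * ∑ T : LabelledTree V, (if T.1.Adj v w then 1 else 0) else 0 := by
        rw [Finset.sum_comm]
        refine Finset.sum_congr rfl fun w _ => ?_
        split_ifs
        · rw [Finset.mul_sum]
        · simp
    _ ≤ ∑ w, if G.Adj v w then
        2 * B * (2 * Fintype.card (LabelledTree V) / Fintype.card V) else 0 := by
        refine Finset.sum_le_sum fun w _ => ?_
        split_ifs
        · exact mul_le_mul_of_nonneg_left (card_adj_le v w) (by positivity)
        · exact le_rfl
    _ = _ := by
        rw [degree_eq_sum_ite, Finset.sum_mul, Finset.mul_sum]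
        refine Finset.sum_congr rfl fun w _ => ?_
        split_ifs <;> ring

open Classical in
/-- The approximate size-bias identity for the number of edges that a uniform tree shares with a
fixed graph. -/
lemma abs_sum_overlap_mul_sub_le (G : SimpleGraph V) {g : ℕ → ℝ} {B : ℝ} (hg : ∀ a, |g a| ≤ B) :
    |Fintype.card V * ∑ T : LabelledTree V, T.1.overlap G * g (T.1.overlap G) -
      2 * G.edgeSet.ncard * ∑ T : LabelledTree V, g (T.1.overlap G + 1)| ≤
      4 * B * Fintype.card (LabelledTree V) / Fintype.card V * ∑ v, (G.degree v : ℝ) ^ 2 := by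
  set A : V → V → ℝ := fun v u => ∑ T : LabelledTree V, ∑ w, (if T.1.NextToward v w u then
        g ((T.1.reroute v w u).overlap G) else 0) with hA
  set S := ∑ T : LabelledTree V, g (T.1.overlap G + 1)
  have e1 : 2 * (Fintype.card V * ∑ T : LabelledTree V, T.1.overlap G * g (T.1.overlap G)) =
      2 * ∑ v, ∑ u, if G.Adj v u then A v u else 0 := by
    calc _ = ∑ T : LabelledTree V, Fintype.card V * ((2 * T.1.overlap G : ℕ) *
          g (T.1.overlap G)) := by
          rw [Finset.mul_sum, Finset.mul_sum]
          refine Finset.sum_congr rfl fun T _ => ?_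
          push_cast
          ring
      _ = ∑ T : LabelledTree V, ∑ v, ∑ u, if G.Adj v u then
          Fintype.card V * (if T.1.Adj v u then g (T.1.overlap G) else 0) else 0 := by
          refine Finset.sum_congr rfl fun T _ => ?_
          rw [two_mul_overlap]
          push_cast
          rw [Finset.sum_mul, Finset.mul_sum]
          refine Finset.sum_congr rfl fun v _ => ?_
          rw [Finset.sum_mul, Finset.mul_sum]
          refine Finset.sum_congr rfl fun u _ => ?_
          by_cases h1 : G.Adj v u <;> by_cases h2 : T.1.Adj v u <;> simp [h1, h2]
      _ = ∑ v, ∑ u, if G.Adj v u then A v u + A u v else 0 := by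
          rw [Finset.sum_comm]
          refine Finset.sum_congr rfl fun v _ => ?_
          rw [Finset.sum_comm]
          refine Finset.sum_congr rfl fun u _ => ?_
          split_ifs
          · rw [hA, ← card_mul_sum_adj v u fun T => g (T.overlap G), Finset.mul_sum]
          · simp
      _ = _ := by
          have : ∀ v u, (if G.Adj v u then A v u + A u v else 0) =
              (if G.Adj v u then A v u else 0) + (if G.Adj u v then A u v else 0) := by
            intro v u
            by_cases h : G.Adj v u
            · simp [h, h.symm]
            · have h' : ¬ G.Adj u v := fun h' => h h'.symm
              simp [h, h']
          simp_rw [this, Finset.sum_add_distrib]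
          rw [Finset.sum_comm (f := fun v u => if G.Adj u v then A u v else 0), two_mul]
  have e2 : (2 * G.edgeSet.ncard * S : ℝ) = ∑ v, ∑ u, if G.Adj v u then S else 0 := by
    have := two_mul_overlap G G
    rw [overlap, inf_idem] at this
    have h2 : (2 * G.edgeSet.ncard : ℝ) = ((2 * G.edgeSet.ncard : ℕ) : ℝ) := by push_cast; rfl
    rw [h2, this]
    push_cast
    simp_rw [Finset.sum_mul, and_self, ite_mul, one_mul, zero_mul]
  rw [mul_left_cancel₀ two_ne_zero e1, e2]
  simp_rw [← Finset.sum_sub_distrib]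
  refine (Finset.abs_sum_le_sum_abs _ _).trans ?_
  rw [Finset.mul_sum]
  refine Finset.sum_le_sum fun v _ => ?_
  calc _ ≤ ∑ u, if G.Adj v u then
        2 * B * (G.degree v * (2 * Fintype.card (LabelledTree V) / Fintype.card V)) else 0 := by
        refine (Finset.abs_sum_le_sum_abs _ _).trans (Finset.sum_le_sum fun u _ => ?_)
        split_ifs with h
        · exact abs_sum_reroute_sub_le G h hg
        · simp
    _ = (G.degree v : ℝ) *
        (2 * B * (G.degree v * (2 * Fintype.card (LabelledTree V) / Fintype.card V))) := by
        nth_rw 2 [degree_eq_sum_ite]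
        rw [Finset.sum_mul]
        simp_rw [ite_mul, one_mul, zero_mul]
    _ = _ := by ring

lemma sum_overlap_eq (G : SimpleGraph V) :
    Fintype.card V * ∑ T : LabelledTree V, (T.1.overlap G : ℝ) =
      2 * G.edgeSet.ncard * Fintype.card (LabelledTree V) := by
  classical
  calc _ = (1 / 2 : ℝ) * ∑ T : LabelledTree V, Fintype.card V * ((2 * T.1.overlap G : ℕ) : ℝ) := by
        rw [Finset.mul_sum, Finset.mul_sum]
        refine Finset.sum_congr rfl fun T _ => ?_
        push_cast
        ring
    _ = (1 / 2 : ℝ) * ∑ v, ∑ u, if G.Adj v u then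
        Fintype.card V * ∑ T : LabelledTree V, (if T.1.Adj v u then (1 : ℝ) else 0) else 0 := by
        simp_rw [two_mul_overlap]
        push_cast
        simp_rw [Finset.mul_sum]
        rw [Finset.sum_comm]
        refine Finset.sum_congr rfl fun v _ => ?_
        rw [Finset.sum_comm]
        refine Finset.sum_congr rfl fun u _ => ?_
        by_cases h1 : G.Adj v u <;> simp [h1, Finset.mul_sum]
    _ = (1 / 2 : ℝ) * ∑ v, ∑ u, if G.Adj v u then
        2 * (Fintype.card (LabelledTree V) : ℝ) else 0 := by
        congr 1
        refine Finset.sum_congr rfl fun v _ => Finset.sum_congr rfl fun u _ => ?_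
        split_ifs with h
        · exact card_mul_card_adj h.ne
        · rfl
    _ = (1 / 2 : ℝ) * (((2 * G.overlap G : ℕ) : ℝ) * (2 * Fintype.card (LabelledTree V))) := by
        rw [two_mul_overlap]
        push_cast
        simp_rw [Finset.sum_mul, and_self, ite_mul, one_mul, zero_mul]
    _ = _ := by
        rw [overlap, inf_idem]
        push_cast
        ring

end Finite
end SimpleGraph

lemma integrable_poissonMeasure_of_bounded {r : NNReal} {h : ℕ → ℝ} {B : ℝ}
    (hh : ∀ a, |h a| ≤ B) : Integrable h (poissonMeasure r) :=
  .of_bound .of_discrete B (.of_forall hh)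

lemma abs_integral_poissonMeasure_le {r : NNReal} {h : ℕ → ℝ} {B : ℝ}
    (hh : ∀ a, |h a| ≤ B) : |∫ a, h a ∂poissonMeasure r| ≤ B := by
  simpa using norm_integral_le_of_norm_le_const (μ := poissonMeasure r) (f := h) (.of_forall hh)

/-- Bounded solutions of the Stein equation for the Poisson distribution with integer rate. -/
lemma exists_stein_solution (m : ℕ) {h : ℕ → ℝ} (hh : ∀ a, |h a| ≤ 1) :
    ∃ g : ℕ → ℝ, (∀ a, |g a| ≤ 2) ∧
      ∀ a, m * g (a + 1) - a * g a = h a - ∫ b, h b ∂poissonMeasure (m : NNReal) := by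
  set c := ∫ b, h b ∂poissonMeasure (m : NNReal) with hc
  have hc1 : |c| ≤ 1 := abs_integral_poissonMeasure_le hh
  rcases Nat.eq_zero_or_pos m with rfl | hm
  · have hc0 : c = h 0 := by
      rw [hc, integral_poissonMeasure, tsum_eq_single 0]
      · simp
      · intro b hb
        simp [hb]
    refine ⟨fun a => (h 0 - h a) / a, fun a => ?_, fun a => ?_⟩
    · rcases Nat.eq_zero_or_pos a with rfl | ha
      · simp
      · have ha' : (1 : ℝ) ≤ a := by exact_mod_cast ha
        rw [abs_div, Nat.abs_cast, div_le_iff₀ (by linarith)]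
        have := (abs_sub (h 0) (h a)).trans (add_le_add (hh 0) (hh a))
        linarith
    · rcases Nat.eq_zero_or_pos a with rfl | ha
      · simp [hc0]
      · have ha' : (a : ℝ) ≠ 0 := by positivity
        rw [hc0]
        field_simp
        push_cast
        ring
  have hm' : (1 : ℝ) ≤ m := by exact_mod_cast hm
  set p : ℕ → ℝ := fun a => Real.exp (-m) * (m : ℝ) ^ a / a.factorial with hp
  have hp0 : ∀ a, 0 < p a := fun a => by positivity
  have hps : ∀ a : ℕ, ((a : ℝ) + 1) * p (a + 1) = m * p a := by
    intro a
    simp only [hp, Nat.factorial_succ, pow_succ]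
    push_cast
    field_simp
  set S : ℕ → ℝ := fun a => ∑ i ∈ Finset.range (a + 1), p i * (h i - c) with hS
  have hS0 : S 0 = p 0 * (h 0 - c) := by simp [hS]
  have hSs : ∀ a, S (a + 1) = S a + p (a + 1) * (h (a + 1) - c) := fun a =>
    Finset.sum_range_succ _ _
  have hf : ∀ a, |p a * (h a - c)| ≤ 2 * p a := by
    intro a
    rw [abs_mul, abs_of_pos (hp0 a), mul_comm]
    exact mul_le_mul_of_nonneg_right
      (((abs_sub _ _).trans (add_le_add (hh a) hc1)).trans (by norm_num)) (hp0 a).le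
  have hlim : Tendsto S atTop (𝓝 0) := by
    have h1 : HasSum (fun a => p a * h a) c := by
      have := hasSum_integral_poissonMeasure
        (integrable_poissonMeasure_of_bounded (r := (m : NNReal)) hh)
      simpa only [smul_eq_mul, NNReal.coe_natCast] using this
    have h2 : HasSum (fun a => p a * c) (1 * c) := by
      have := (hasSum_one_poissonMeasure (m : NNReal)).mul_right c
      simpa only [NNReal.coe_natCast] using this
    have h3 := (h1.sub h2).tendsto_sum_nat
    rw [one_mul, sub_self] at h3
    simp_rw [← mul_sub] at h3
    exact h3.comp (tendsto_add_atTop_nat 1)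
  have hSb : ∀ a, |S a| ≤ 2 * (m * p a) := by
    intro a
    rcases Nat.lt_or_ge a m with ha | ha
    · induction a with
      | zero =>
        rw [hS0]
        have := hf 0
        nlinarith [hp0 0]
      | succ b ih =>
        rw [hSs]
        have h1 := ih (by omega)
        have h2 := hf (b + 1)
        rw [← hps] at h1
        have h3 : ((b : ℝ) + 1) + 1 ≤ m := by exact_mod_cast ha
        have h4 := mul_le_mul_of_nonneg_right h3 (hp0 (b + 1)).le
        refine (abs_add_le _ _).trans ?_
        linarith
    · have key : ∀ N, a ≤ N → |S N - S a| ≤ 2 * (m * p a) - 2 * (m * p N) := by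
        intro N hN
        induction N, hN using Nat.le_induction with
        | base => simp
        | succ N hN ih =>
          have h2 := hf (N + 1)
          have h3 : (m : ℝ) ≤ N := by exact_mod_cast ha.trans hN
          have h4 := hps N
          have h5 := mul_le_mul_of_nonneg_right h3 (hp0 (N + 1)).le
          rw [hSs, add_sub_right_comm]
          refine (abs_add_le _ _).trans ?_
          linarith
      have h1 : Tendsto (fun N => |S N - S a|) atTop (𝓝 |0 - S a|) :=
        (hlim.sub tendsto_const_nhds).abs
      rw [zero_sub, abs_neg] at h1
      refine le_of_tendsto h1 ?_
      filter_upwards [eventually_ge_atTop a] with N hN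
      have := key N hN
      have := hp0 N
      nlinarith
  refine ⟨fun a => Nat.casesOn a 0 fun b => S b / (m * p b), fun a => ?_, fun a => ?_⟩
  · cases a with
    | zero => simp
    | succ b =>
      have := mul_pos (zero_lt_one.trans_le hm') (hp0 b)
      simp only
      rw [abs_div, abs_of_pos this, div_le_iff₀ this]
      exact hSb b
  · have hm0 : (m : ℝ) ≠ 0 := by positivity
    cases a with
    | zero =>
      have := (hp0 0).ne'
      simp only [hS0]
      field_simp
      simp
    | succ b =>
      have h1 := (hp0 b).ne'
      have h2 := (hp0 (b + 1)).ne'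
      have h3 := hps b
      simp only [hSs]
      rw [← h3]
      have h4 : (b : ℝ) + 1 ≠ 0 := by positivity
      have h5 : (m : ℝ) * ((S b + p (b + 1) * (h (b + 1) - c)) / (m * p (b + 1))) =
          S b / p (b + 1) + (h (b + 1) - c) := by
        field_simp
      rw [h5]
      push_cast
      field_simp
      ring

namespace SimpleGraph
variable {V : Type*} [Fintype V]

open Classical in
/-- Poisson approximation of the number of edges that a uniform tree shares with a fixed graph. -/
lemma abs_expect_overlap_sub_le [Nonempty V] (G : SimpleGraph V) (m : ℕ) {h : ℕ → ℝ}
    (hh : ∀ a, |h a| ≤ 1) :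
    |Finset.expect Finset.univ (fun T : LabelledTree V => h (T.1.overlap G)) -
        ∫ b, h b ∂poissonMeasure (m : NNReal)| ≤
      2 * |m - 2 * G.edgeSet.ncard / (Fintype.card V : ℝ)| +
        8 / (Fintype.card V : ℝ) ^ 2 * ∑ v, (G.degree v : ℝ) ^ 2 := by
  obtain ⟨g, hg, hs⟩ := exists_stein_solution m hh
  set c := ∫ b, h b ∂poissonMeasure (m : NNReal)
  have hn : (0 : ℝ) < Fintype.card V := by positivity
  have hN : (0 : ℝ) < Fintype.card (LabelledTree V) := by positivity
  have key := abs_sum_overlap_mul_sub_le G hg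
  have hS : |∑ T : LabelledTree V, g (T.1.overlap G + 1)| ≤
      2 * Fintype.card (LabelledTree V) := by
    refine (Finset.abs_sum_le_sum_abs _ _).trans ((Finset.sum_le_sum fun T _ => hg _).trans ?_)
    simp [mul_comm]
  have hE : ∑ T : LabelledTree V, h (T.1.overlap G) - Fintype.card (LabelledTree V) * c =
      m * ∑ T : LabelledTree V, g (T.1.overlap G + 1) -
        ∑ T : LabelledTree V, T.1.overlap G * g (T.1.overlap G) := by
    rw [Finset.mul_sum, ← Finset.sum_sub_distrib, Finset.sum_congr rfl fun T _ => hs _,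
      Finset.sum_sub_distrib]
    simp
  set S := ∑ T : LabelledTree V, g (T.1.overlap G + 1)
  set R := ∑ T : LabelledTree V, T.1.overlap G * g (T.1.overlap G)
  rw [Fintype.expect_eq_sum_div_card]
  set n : ℝ := ((Fintype.card V : ℕ) : ℝ)
  set N : ℝ := ((Fintype.card (LabelledTree V) : ℕ) : ℝ)
  set Q := ∑ v, (G.degree v : ℝ) ^ 2
  set e : ℝ := (G.edgeSet.ncard : ℝ)
  have h1 : (∑ T : LabelledTree V, h (T.1.overlap G)) / N - c =
      ((m - 2 * e / n) * S - (n * R - 2 * e * S) / n) / N := by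
    rw [eq_div_iff hN.ne', sub_mul, div_mul_cancel₀ _ hN.ne', mul_comm c, hE]
    field_simp
    ring
  rw [h1, abs_div, abs_of_pos hN, div_le_iff₀ hN]
  refine (abs_sub _ _).trans ?_
  rw [abs_mul, abs_div, abs_of_pos hn]
  have h2 : |m - 2 * e / n| * |S| ≤ |m - 2 * e / n| * (2 * N) :=
    mul_le_mul_of_nonneg_left hS (abs_nonneg _)
  have h3 : |n * R - 2 * e * S| / n ≤ (4 * 2 * N / n * Q) / n :=
    div_le_div_of_nonneg_right key hn.le
  have h4 : (4 * 2 * N / n * Q) / n = 8 / n ^ 2 * Q * N := by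
    field_simp
    ring
  linarith

end SimpleGraph

open scoped BigOperators

lemma expect_fin_succ {X : Type*} [Fintype X] (k : ℕ) (F : (Fin (k + 1) → X) → ℝ) :
    𝔼 T, F T = 𝔼 T : Fin k → X, 𝔼 t, F (Fin.cons t T) := by
  rw [Finset.expect_comm, ← Finset.expect_product']
  exact (Fintype.expect_equiv (Fin.consEquiv fun _ => X) _ _ fun _ => rfl).symm

lemma expect_sum_apply {X : Type*} [Fintype X] [Nonempty X] (k : ℕ) (f : X → ℝ) :
    𝔼 T : Fin k → X, ∑ i, f (T i) = k * 𝔼 t, f t := by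
  induction k with
  | zero => simp
  | succ k ih =>
    rw [expect_fin_succ]
    simp only [Fin.sum_univ_succ, Fin.cons_zero, Fin.cons_succ, Finset.expect_add_distrib,
      Fintype.expect_const, ih]
    push_cast
    ring

section Deficit
open SimpleGraph
variable {n k : ℕ}

lemma SimpleGraph.IsTree.ncard_edgeSet {T : SimpleGraph (Fin n)} (hT : T.IsTree) :
    (T.edgeSet.ncard : ℤ) = n - 1 := by
  have h := (isTree_iff_connected_and_card.1 hT).2
  rw [Nat.card_coe_set_eq, Nat.card_fin] at h
  omega

lemma unionDeficit_cons (t : LabelledTree (Fin n)) (T : Fin k → LabelledTree (Fin n)) :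
    unionDeficit (fun i => ((Fin.cons t T : Fin (k + 1) → LabelledTree (Fin n)) i).1) =
      unionDeficit (fun i => (T i).1) + t.1.overlap (⨆ i, (T i).1) := by
  have h : (⋃ i, ((Fin.cons t T : Fin (k + 1) → LabelledTree (Fin n)) i).1.edgeSet) =
      t.1.edgeSet ∪ ⋃ i, (T i).1.edgeSet := by
    ext e
    simp [Fin.exists_fin_succ]
  have h2 := Set.ncard_union_add_ncard_inter t.1.edgeSet (⋃ i, (T i).1.edgeSet)
  have h3 := t.2.ncard_edgeSet
  rw [unionDeficit, unionDeficit, h, overlap, edgeSet_inf, edgeSet_iSup]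
  push_cast
  have h4 : ((k : ℤ) + 1) * (n - 1) = k * (n - 1) + (n - 1) := by ring
  rw [h4]
  omega

lemma unionDeficit_nonneg (T : Fin k → LabelledTree (Fin n)) :
    0 ≤ unionDeficit (fun i => (T i).1) := by
  induction k with
  | zero => simp [unionDeficit]
  | succ k ih =>
    rw [← Fin.cons_self_tail T, unionDeficit_cons]
    have := ih (Fin.tail T)
    positivity

lemma ncard_edgeSet_iSup (T : Fin k → LabelledTree (Fin n)) :
    ((⨆ i, (T i).1 : SimpleGraph (Fin n)).edgeSet.ncard : ℝ) =
      k * (n - 1) - (unionDeficit (fun i => (T i).1) : ℝ) := by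
  rw [unionDeficit, edgeSet_iSup]
  push_cast
  ring

lemma expect_overlap [NeZero n] (G : SimpleGraph (Fin n)) :
    𝔼 t : LabelledTree (Fin n), (t.1.overlap G : ℝ) = 2 * G.edgeSet.ncard / n := by
  have h := sum_overlap_eq G
  rw [Fintype.card_fin] at h
  have hn : (n : ℝ) ≠ 0 := NeZero.ne _
  have hN : (0 : ℝ) < Fintype.card (LabelledTree (Fin n)) := by positivity
  rw [Fintype.expect_eq_sum_div_card, div_eq_div_iff hN.ne' hn, mul_comm, h]

lemma expect_unionDeficit_le [NeZero n] (k : ℕ) :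
    𝔼 T : Fin k → LabelledTree (Fin n), (unionDeficit (fun i => (T i).1) : ℝ) ≤ (k : ℝ) ^ 2 := by
  have hn : (0 : ℝ) < n := by exact_mod_cast Nat.pos_of_ne_zero (NeZero.ne n)
  induction k with
  | zero => simp [unionDeficit]
  | succ k ih =>
    rw [expect_fin_succ]
    calc _ ≤ 𝔼 T : Fin k → LabelledTree (Fin n),
          ((unionDeficit (fun i => (T i).1) : ℝ) + 2 * k) := by
          refine Finset.expect_le_expect fun T _ => ?_
          simp_rw [unionDeficit_cons]
          push_cast
          rw [Finset.expect_add_distrib, Fintype.expect_const, expect_overlap, ncard_edgeSet_iSup]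
          have : (0 : ℝ) ≤ unionDeficit (fun i => (T i).1) := by
            exact_mod_cast unionDeficit_nonneg T
          gcongr
          rw [div_le_iff₀ hn]
          have hk : (0 : ℝ) ≤ k := k.cast_nonneg
          nlinarith
      _ ≤ ((k + 1 : ℕ) : ℝ) ^ 2 := by
          rw [Finset.expect_add_distrib, Fintype.expect_const]
          push_cast
          linarith

open Classical in
lemma expect_sum_degree_sq_le [NeZero n] (k : ℕ) (v : Fin n) :
    𝔼 T : Fin k → LabelledTree (Fin n), ∑ i, ((T i).1.degree v : ℝ) ^ 2 ≤ 6 * k := by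
  have hN : (0 : ℝ) < Fintype.card (LabelledTree (Fin n)) := by positivity
  have h : 𝔼 t : LabelledTree (Fin n), (t.1.degree v : ℝ) ^ 2 ≤ 6 := by
    rw [Fintype.expect_eq_sum_div_card, div_le_iff₀ hN]
    exact sum_degree_sq_le v
  rw [expect_sum_apply k fun t : LabelledTree (Fin n) => (t.1.degree v : ℝ) ^ 2, mul_comm]
  exact mul_le_mul_of_nonneg_right h k.cast_nonneg

open Classical in
lemma expect_degree_iSup_sq_le [NeZero n] (k : ℕ) (v : Fin n) :
    𝔼 T : Fin k → LabelledTree (Fin n), ((⨆ i, (T i).1 : SimpleGraph (Fin n)).degree v : ℝ) ^ 2 ≤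
      6 * (k : ℝ) ^ 2 := by
  calc _ ≤ 𝔼 T : Fin k → LabelledTree (Fin n), k * ∑ i, ((T i).1.degree v : ℝ) ^ 2 := by
        refine Finset.expect_le_expect fun T _ => ?_
        have h1 : ((⨆ i, (T i).1 : SimpleGraph (Fin n)).degree v : ℝ) ≤
            ∑ i, ((T i).1.degree v : ℝ) := by
          simp_rw [degree_eq_sum_ite]
          rw [Finset.sum_comm]
          refine Finset.sum_le_sum fun u _ => ?_
          split_ifs with h
          · obtain ⟨i, hi⟩ := iSup_adj.1 h
            refine le_trans (by rw [if_pos hi]) (Finset.single_le_sum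
              (f := fun i => if (T i).1.Adj v u then (1 : ℝ) else 0) (fun j _ => ?_)
              (Finset.mem_univ i))
            positivity
          · positivity
        have h2 := sq_sum_le_card_mul_sum_sq (s := Finset.univ)
          (f := fun i => ((T i).1.degree v : ℝ))
        rw [Finset.card_univ, Fintype.card_fin] at h2
        exact (pow_le_pow_left₀ (Nat.cast_nonneg _) h1 2).trans h2
    _ ≤ k * (6 * k) := by
        rw [← Finset.mul_expect]
        exact mul_le_mul_of_nonneg_left (expect_sum_degree_sq_le k v) k.cast_nonneg
    _ = _ := by ring

lemma poissonRate_succ (k : ℕ) : poissonRate k + ((2 * k : ℕ) : NNReal) = poissonRate (k + 1) := by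
  rw [poissonRate, poissonRate, ← Nat.cast_add]
  congr 1
  cases k with
  | zero => rfl
  | succ k => simp only [Nat.add_sub_cancel]; ring

lemma integral_poissonMeasure_add (r s : NNReal) {h : ℤ → ℝ} {B : ℝ} (hh : ∀ z, |h z| ≤ B) :
    ∫ a : ℕ, ∫ b : ℕ, h (a + b) ∂poissonMeasure s ∂poissonMeasure r =
      ∫ b : ℕ, h b ∂poissonMeasure (r + s) := by
  rw [← poissonMeasure_conv_poissonMeasure, integral_conv]
  · simp
  · exact .of_bound .of_discrete B (.of_forall fun a => hh a)

/-- Poisson approximation of the number of edges lost in a union of `k` uniform trees, against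
bounded test functions. -/
theorem abs_expect_unionDeficit_sub_le [NeZero n] (k : ℕ) {h : ℤ → ℝ} (hh : ∀ z, |h z| ≤ 1) :
    |𝔼 T : Fin k → LabelledTree (Fin n), h (unionDeficit fun i => (T i).1) -
      ∫ b : ℕ, h b ∂poissonMeasure (poissonRate k)| ≤ 56 * (k : ℝ) ^ 3 / n := by
  classical
  have hn : (0 : ℝ) < n := by exact_mod_cast Nat.pos_of_ne_zero (NeZero.ne n)
  induction k generalizing h with
  | zero =>
    have h1 : ∫ b : ℕ, h b ∂poissonMeasure (poissonRate 0) = h 0 := by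
      rw [integral_poissonMeasure, tsum_eq_single 0]
      · simp [poissonRate]
      · intro b hb
        simp [poissonRate, hb]
    rw [h1]
    simp [unionDeficit]
  | succ k ih =>
    set μ := poissonMeasure ((2 * k : ℕ) : NNReal) with hμ
    set h' : ℤ → ℝ := fun z => ∫ b : ℕ, h (z + b) ∂μ with hh'
    have hb : ∀ z, |h' z| ≤ 1 := fun z => abs_integral_poissonMeasure_le fun a => hh _
    have h1 := ih hb
    rw [integral_poissonMeasure_add _ _ hh, poissonRate_succ] at h1
    rw [expect_fin_succ]
    simp_rw [unionDeficit_cons]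
    have step : ∀ T : Fin k → LabelledTree (Fin n),
        |𝔼 t : LabelledTree (Fin n), h (unionDeficit (fun i => (T i).1) +
          t.1.overlap (⨆ i, (T i).1)) - h' (unionDeficit fun i => (T i).1)| ≤
        4 / n * (k + (unionDeficit fun i => (T i).1 : ℝ)) +
          8 / (n : ℝ) ^ 2 * ∑ v, ((⨆ i, (T i).1 : SimpleGraph (Fin n)).degree v : ℝ) ^ 2 := by
      intro T
      have h2 := abs_expect_overlap_sub_le (⨆ i, (T i).1) (2 * k)
        (h := fun b => h (unionDeficit (fun i => (T i).1) + b)) fun a => hh _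
      rw [Fintype.card_fin] at h2
      refine h2.trans (add_le_add (le_of_eq ?_) le_rfl)
      have h3 : (0 : ℝ) ≤ unionDeficit (fun i => (T i).1) := by
        exact_mod_cast unionDeficit_nonneg T
      have h4 : ((2 * k : ℕ) : ℝ) - 2 * (⨆ i, (T i).1 : SimpleGraph (Fin n)).edgeSet.ncard / n =
          2 / n * (k + (unionDeficit fun i => (T i).1 : ℝ)) := by
        rw [ncard_edgeSet_iSup]
        push_cast
        field_simp
        ring
      rw [h4, abs_of_nonneg (by positivity)]
      ring
    have h5 : |𝔼 T : Fin k → LabelledTree (Fin n), 𝔼 t : LabelledTree (Fin n),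
          h (unionDeficit (fun i => (T i).1) + t.1.overlap (⨆ i, (T i).1)) -
        𝔼 T : Fin k → LabelledTree (Fin n), h' (unionDeficit fun i => (T i).1)| ≤
        4 / n * (k + (k : ℝ) ^ 2) + 8 / (n : ℝ) ^ 2 * (n * (6 * (k : ℝ) ^ 2)) := by
      rw [← Finset.expect_sub_distrib]
      refine (Finset.abs_expect_le _ _).trans
        ((Finset.expect_le_expect fun T _ => step T).trans ?_)
      rw [Finset.expect_add_distrib, ← Finset.mul_expect, ← Finset.mul_expect,
        Finset.expect_add_distrib, Fintype.expect_const, Finset.expect_sum_comm]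
      have h6 := expect_unionDeficit_le (n := n) k
      have h7 : ∑ v : Fin n, 𝔼 T : Fin k → LabelledTree (Fin n),
          ((⨆ i, (T i).1 : SimpleGraph (Fin n)).degree v : ℝ) ^ 2 ≤ n * (6 * (k : ℝ) ^ 2) := by
        refine (Finset.sum_le_sum fun v _ => expect_degree_iSup_sq_le k v).trans ?_
        simp
      gcongr
    have h8 := (abs_sub_le _ _ _).trans (add_le_add h5 h1)
    refine h8.trans ?_
    have hk : (k : ℝ) ≤ (k : ℝ) ^ 2 := by exact_mod_cast Nat.le_self_pow two_ne_zero k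
    have h9 : 4 / n * (k + (k : ℝ) ^ 2) + 8 / (n : ℝ) ^ 2 * (n * (6 * (k : ℝ) ^ 2)) +
        56 * (k : ℝ) ^ 3 / n = (4 * k + 52 * (k : ℝ) ^ 2 + 56 * (k : ℝ) ^ 3) / n := by
      field_simp
      ring
    rw [h9]
    push_cast
    gcongr
    nlinarith

end Deficit

instance {V : Type*} [Countable V] : MeasurableSingletonClass (SimpleGraph V) where
  measurableSet_singleton G := by
    have h : ({G} : Set (SimpleGraph V)) = SimpleGraph.Adj ⁻¹' {G.Adj} := by
      ext H
      simp only [Set.mem_singleton_iff, Set.mem_preimage, SimpleGraph.adj_inj]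
    rw [h]
    exact SimpleGraph.measurable_adj (measurableSet_singleton _)

section
open SimpleGraph
variable {n k : ℕ} {Ω : Type*} [MeasurableSpace Ω] {P : Measure Ω}
  {T : Fin k → Ω → SimpleGraph (Fin n)}

lemma hasLaw_uniformOn_pi
    (hunif : ∀ i, HasLaw (T i) (uniformOn (spanningTrees (⊤ : SimpleGraph (Fin n)))) P)
    (hindep : iIndepFun T P) :
    HasLaw (fun ω i => T i ω)
      (uniformOn (Set.univ.pi fun _ : Fin k => spanningTrees (⊤ : SimpleGraph (Fin n)))) P where
  aemeasurable := aemeasurable_pi_lambda _ fun i => (hunif i).aemeasurable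
  map_eq := by
    rw [hindep.map_fun_eq_pi_map fun i => (hunif i).aemeasurable, uniformOn_pi]
    simp_rw [fun i => (hunif i).map_eq]

open Classical in
lemma uniformOn_pi_spanningTrees_real (A : Set (Fin k → SimpleGraph (Fin n))) :
    (uniformOn (Set.univ.pi fun _ : Fin k => spanningTrees (⊤ : SimpleGraph (Fin n)))).real A =
      𝔼 T : Fin k → LabelledTree (Fin n), if (fun i => (T i).1) ∈ A then (1 : ℝ) else 0 := by
  have hinj : Function.Injective
      fun (T : Fin k → LabelledTree (Fin n)) (i : Fin k) => (T i).1 :=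
    fun S T h => funext fun i => Subtype.ext (congrFun h i)
  have h : (Set.univ.pi fun _ : Fin k => spanningTrees (⊤ : SimpleGraph (Fin n))) =
      ((Finset.univ.image fun (T : Fin k → LabelledTree (Fin n)) (i : Fin k) => (T i).1 :
        Finset (Fin k → SimpleGraph (Fin n))) : Set _) := by
    ext S
    simp only [Set.mem_pi, Set.mem_univ, true_imp_iff, spanningTrees, le_top, true_and,
      Set.mem_ofPred_eq, Finset.coe_image, Finset.coe_univ, Set.image_univ, Set.mem_range]
    exact ⟨fun hS => ⟨fun i => ⟨S i, hS i⟩, rfl⟩, by rintro ⟨T, rfl⟩ i; exact (T i).2⟩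
  have hA : uniformOn (Set.univ.pi fun _ : Fin k => spanningTrees (⊤ : SimpleGraph (Fin n))) A =
      uniformOn (Set.univ.pi fun _ : Fin k => spanningTrees (⊤ : SimpleGraph (Fin n)))
        (A.toFinset : Set _) := by rw [Set.coe_toFinset]
  rw [measureReal_def, hA, h, uniformOn_apply_finset,
    Finset.card_image_of_injective _ hinj, Fintype.expect_eq_sum_div_card, Finset.sum_boole,
    ENNReal.toReal_div, ENNReal.toReal_natCast, ENNReal.toReal_natCast, Finset.card_univ]
  congr 2
  rw [← Finset.card_image_of_injective _ hinj]
  congr 1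
  ext S
  simp only [Finset.mem_inter, Finset.mem_image, Finset.mem_univ, true_and, Set.mem_toFinset,
    Finset.mem_filter]
  constructor
  · rintro ⟨⟨T, rfl⟩, hA⟩
    exact ⟨T, hA, rfl⟩
  · rintro ⟨T, hA, rfl⟩
    exact ⟨⟨T, rfl⟩, hA⟩

open Classical in
lemma measureReal_unionDeficit
    (hunif : ∀ i, HasLaw (T i) (uniformOn (spanningTrees (⊤ : SimpleGraph (Fin n)))) P)
    (hindep : iIndepFun T P) (A : Set ℤ) :
    P.real {ω | unionDeficit (fun i => T i ω) ∈ A} =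
      𝔼 T : Fin k → LabelledTree (Fin n),
        if unionDeficit (fun i => (T i).1) ∈ A then (1 : ℝ) else 0 := by
  rw [(hasLaw_uniformOn_pi hunif hindep).measureReal_eq
    (p := fun T => unionDeficit T ∈ A) .of_discrete, uniformOn_pi_spanningTrees_real]
  rfl

variable {M : Ω → ℤ}

lemma tvDist_unionDeficit_le [NeZero n]
    (hunif : ∀ i, HasLaw (T i) (uniformOn (spanningTrees (⊤ : SimpleGraph (Fin n)))) P)
    (hindep : iIndepFun T P) (hM : ∀ ω, M ω = unionDeficit (fun i => T i ω)) :
    tvDist (P.map M) (poissonInt (poissonRate k)) ≤ 56 * (k : ℝ) ^ 3 / n := by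
  classical
  have hMm : AEMeasurable M P := by
    have : M = unionDeficit ∘ fun ω i => T i ω := funext hM
    rw [this]
    exact Measurable.of_discrete.comp_aemeasurable (hasLaw_uniformOn_pi hunif hindep).aemeasurable
  have : Nonempty {A : Set ℤ // MeasurableSet A} := ⟨⟨∅, .empty⟩⟩
  refine ciSup_le fun A => ?_
  have h := abs_expect_unionDeficit_sub_le (n := n) k
    (h := fun z => if z ∈ A.1 then (1 : ℝ) else 0) fun z => by split_ifs <;> simp
  rw [← measureReal_unionDeficit hunif hindep A.1] at h
  have h1 : (P.map M).real A.1 = P.real {ω | unionDeficit (fun i => T i ω) ∈ A.1} := by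
    rw [map_measureReal_apply_of_aemeasurable hMm A.2]
    congr 1
    ext ω
    simp [hM]
  have h2 : (poissonInt (poissonRate k)).real A.1 =
      ∫ b : ℕ, (if (b : ℤ) ∈ A.1 then (1 : ℝ) else 0) ∂poissonMeasure (poissonRate k) := by
    rw [poissonInt, map_measureReal_apply .of_discrete A.2, ← integral_indicator_one .of_discrete]
    rfl
  rw [h1, h2]
  exact h

lemma sum_massGap_unionDeficit_le [NeZero n]
    (hunif : ∀ i, HasLaw (T i) (uniformOn (spanningTrees (⊤ : SimpleGraph (Fin n)))) P)
    (hindep : iIndepFun T P) (hM : ∀ ω, M ω = unionDeficit (fun i => T i ω)) (s : Finset ℕ) :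
    ∑ a ∈ s, massGap P M (poissonRate k) a ≤ 56 * (k : ℝ) ^ 3 / n := by
  classical
  set d : ℕ → ℝ := fun a => P.real {ω | M ω = (a : ℤ)} -
    (poissonMeasure (poissonRate k)).real {a} with hd
  set h : ℤ → ℝ := fun z => ∑ a ∈ s, SignType.sign (d a) * if z = (a : ℤ) then (1 : ℝ) else 0
    with hh
  have hb : ∀ z, |h z| ≤ 1 := by
    intro z
    by_cases hz : ∃ a ∈ s, z = (a : ℤ)
    · obtain ⟨a, ha, rfl⟩ := hz
      rw [hh]
      simp only [Nat.cast_inj, mul_ite, mul_one, mul_zero, Finset.sum_ite_eq, if_pos ha]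
      rcases lt_trichotomy (d a) 0 with h0 | h0 | h0 <;> simp [h0]
    · have : h z = 0 := Finset.sum_eq_zero fun a ha => by
        rw [if_neg fun e => hz ⟨a, ha, e⟩, mul_zero]
      simp [this]
  have key := abs_expect_unionDeficit_sub_le (n := n) k hb
  have h1 : 𝔼 T : Fin k → LabelledTree (Fin n), h (unionDeficit fun i => (T i).1) =
      ∑ a ∈ s, SignType.sign (d a) * P.real {ω | M ω = (a : ℤ)} := by
    simp_rw [hh, Finset.expect_sum_comm, ← Finset.mul_expect]
    refine Finset.sum_congr rfl fun a _ => ?_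
    have := measureReal_unionDeficit hunif hindep {(a : ℤ)}
    simp only [Set.mem_singleton_iff] at this
    simp_rw [hM, this]
  have h2 : ∫ b : ℕ, h b ∂poissonMeasure (poissonRate k) =
      ∑ a ∈ s, SignType.sign (d a) * (poissonMeasure (poissonRate k)).real {a} := by
    simp_rw [hh]
    rw [integral_finsetSum]
    · refine Finset.sum_congr rfl fun a _ => ?_
      rw [integral_const_mul, ← integral_indicator_one .of_discrete]
      congr 2
      ext b
      simp [Set.indicator_apply]
    · intro a _
      refine Integrable.const_mul (integrable_poissonMeasure_of_bounded (B := 1) fun b => ?_) _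
      split_ifs <;> simp
  rw [h1, h2, ← Finset.sum_sub_distrib] at key
  refine le_trans (le_of_eq ?_) ((le_abs_self _).trans key)
  refine Finset.sum_congr rfl fun a _ => ?_
  rw [← mul_sub]
  exact (sign_mul_self (d a)).symm

end

theorem theorem1 (α : ℝ) (hα : α ∈ Set.Ioo (0 : ℝ) (1 / 11))
    (k : ℕ → ℕ) (hk : (fun n : ℕ => (k n : ℝ)) =O[atTop] fun n : ℕ => (n : ℝ) ^ α)
    {Ω : ℕ → Type*} [∀ n, MeasurableSpace (Ω n)]
    (P : (n : ℕ) → Measure (Ω n)) [∀ n, IsProbabilityMeasure (P n)]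
    (T : (n : ℕ) → Fin (k n) → Ω n → SimpleGraph (Fin n))
    (hunif : ∀ n, 1 ≤ n → ∀ i,
      HasLaw (T n i) (uniformOn (spanningTrees (⊤ : SimpleGraph (Fin n)))) (P n))
    (hindep : ∀ n, 1 ≤ n → iIndepFun (T n) (P n))
    (M : (n : ℕ) → Ω n → ℤ)
    (hM : ∀ n ω, M n ω = unionDeficit (fun i => T n i ω)) :
    -- total variation distance, with its rate
    Tendsto (fun n => tvDist ((P n).map (M n)) (poissonInt (poissonRate (k n)))) atTop (𝓝 0) ∧
    (fun n => tvDist ((P n).map (M n)) (poissonInt (poissonRate (k n))))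
      =O[atTop] (fun n : ℕ => (n : ℝ) ^ (11 * α) / (n : ℝ)) ∧
    -- the sum of the differences of the point probabilities, with its rate
    (∀ n, 1 ≤ n → Summable (massGap (P n) (M n) (poissonRate (k n)))) ∧
    Tendsto (fun n => ∑' a : ℕ, massGap (P n) (M n) (poissonRate (k n)) a) atTop (𝓝 0) ∧
    (fun n => ∑' a : ℕ, massGap (P n) (M n) (poissonRate (k n)) a)
      =O[atTop] (fun n : ℕ => (n : ℝ) ^ (11 * α) / (n : ℝ)) := by

  have hrate : (fun n : ℕ => 56 * (k n : ℝ) ^ 3 / n) =O[atTop]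
      fun n : ℕ => (n : ℝ) ^ (11 * α) / (n : ℝ) := by
    have h1 : (fun n : ℕ => (k n : ℝ) ^ 3) =O[atTop] fun n : ℕ => (n : ℝ) ^ (11 * α) := by
      refine (hk.pow 3).trans (IsBigO.of_bound 1 ?_)
      filter_upwards [eventually_ge_atTop 1] with n hn
      have hn' : (1 : ℝ) ≤ n := by exact_mod_cast hn
      rw [← Real.rpow_mul_natCast (by positivity), one_mul, Real.norm_of_nonneg (by positivity),
        Real.norm_of_nonneg (by positivity)]
      refine Real.rpow_le_rpow_of_exponent_le hn' ?_
      have := hα.1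
      push_cast
      linarith
    exact (h1.const_mul_left 56).mul (isBigO_refl (fun n : ℕ => ((n : ℝ))⁻¹) atTop)
  have hzero : Tendsto (fun n : ℕ => (n : ℝ) ^ (11 * α) / (n : ℝ)) atTop (𝓝 0) := by
    have h1 : 0 < 1 - 11 * α := by
      have := hα.2
      linarith
    refine ((tendsto_rpow_neg_atTop h1).comp tendsto_natCast_atTop_atTop).congr' ?_
    filter_upwards [eventually_ge_atTop 1] with n hn
    have hn' : (0 : ℝ) < n := by exact_mod_cast hn
    rw [Function.comp_apply, neg_sub, Real.rpow_sub_one hn'.ne']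
  have htv : (fun n => tvDist ((P n).map (M n)) (poissonInt (poissonRate (k n))))
      =O[atTop] (fun n : ℕ => (n : ℝ) ^ (11 * α) / (n : ℝ)) := by
    refine IsBigO.trans (IsBigO.of_bound 1 ?_) hrate
    filter_upwards [eventually_ge_atTop 1] with n hn
    have : NeZero n := ⟨by omega⟩
    have hnn : 0 ≤ tvDist ((P n).map (M n)) (poissonInt (poissonRate (k n))) :=
      Real.iSup_nonneg fun _ => abs_nonneg _
    rw [one_mul, Real.norm_of_nonneg hnn]
    exact (tvDist_unionDeficit_le (hunif n hn) (hindep n hn) (hM n)).trans (le_abs_self _)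
  have hnn : ∀ n a, 0 ≤ massGap (P n) (M n) (poissonRate (k n)) a := fun _ _ => abs_nonneg _
  have hsum : (fun n => ∑' a : ℕ, massGap (P n) (M n) (poissonRate (k n)) a)
      =O[atTop] (fun n : ℕ => (n : ℝ) ^ (11 * α) / (n : ℝ)) := by
    refine IsBigO.trans (IsBigO.of_bound 1 ?_) hrate
    filter_upwards [eventually_ge_atTop 1] with n hn
    have : NeZero n := ⟨by omega⟩
    rw [one_mul, Real.norm_of_nonneg (tsum_nonneg (hnn n))]
    exact (Real.tsum_le_of_sum_le (hnn n)
      (sum_massGap_unionDeficit_le (hunif n hn) (hindep n hn) (hM n))).trans (le_abs_self _)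
  refine ⟨htv.trans_tendsto hzero, htv, fun n hn => ?_, hsum.trans_tendsto hzero, hsum⟩
  have : NeZero n := ⟨by omega⟩
  exact summable_of_sum_le (hnn n)
    (sum_massGap_unionDeficit_le (hunif n hn) (hindep n hn) (hM n))
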